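/- Let $n,d\ge 0$, let $M\in\mathbb R^{n\times n}$ be a \emph{sufficient} matrix, i.e. for $N=M$ and for $N=M^T$ and all $z\in\mathbb R^n$: if $z_i(Nz)_i\le 0$ for all $i$, then $z_i(Nz)_i=0$ for all $i$. Let $Q\in\mathbb R^{n\times d}$ have rank $d$, let $q\in\mathbb R^n$, and let $S=\{q+Q\theta \mid \theta\in\mathbb R^d\}$. Put $A=[\,I\;\;-M\,]\in\mathbb R^{n\times 2n}$. A \emph{complementary basis} is a set $B\subset\{1,\dots,2n\}$ with $|B|=n$, with $|B\cap\{i,n+i\}|=1$ for $i=1,\dots,n$, and such that the submatrix $A_B$ of the columns of $A$ indexed by $B$ has rank $n$. Let $\mathcal C(B)$ be the cone of all nonnegative combinations of the columns of $A_B$, and let $S_B=\mathcal C(B)\cap S$ be the \emph{critical domain} of $B$. Assume that $S$ is in \emph{general position}: for every complementary basis $B$, if $S$ intersects $\mathcal C(B)$, then $S$ intersects the interior of $\mathcal C(B)$. The \emph{critical domain graph} $\mathcal G$ has as nodes the complementary bases $B$ with $\dim S_B=d$, and two distinct nodes $B_1,B_2$ are joined by an edge if and only if $\dim(S_{B_1}\cap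 S_{B_2})=d-1$. Here the dimension of a set is that of its affine hull, and $\dim\emptyset=-1$. Then $\mathcal G$ is connected, in the sense that any two of its nodes are joined by a path in $\mathcal G$. Moreover, $\mathcal G$ has at least one node if the parametric linear complementarity problem is feasible, that is, if there are $\theta\in\mathbb R^d$ and $w,z\in\mathbb R^n$ with $w-Mz=q+Q\theta$, $w\ge 0$, $z\ge 0$ and $w^Tz=0$. -/

import Mathlib

namespace PLCP

variable {n d : ℕ}

/-- Column sufficiency of a square real matrix. -/
def ColumnSufficient (M : Matrix (Fin n) (Fin n) ℝ) : Prop :=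
  ∀ z : Fin n → ℝ, (∀ i, z i * (M.mulVec z) i ≤ 0) → ∀ i, z i * (M.mulVec z) i = 0

/-- A matrix is sufficient if it and its transpose are column sufficient. -/
def Sufficient (M : Matrix (Fin n) (Fin n) ℝ) : Prop :=
  ColumnSufficient M ∧ ColumnSufficient M.transpose

/-- The matrix `A = [I  -M]`. The column index `Sum.inl i` stands for `i` and `Sum.inr i` for
its complementary index `n + i`. -/
def matA (M : Matrix (Fin n) (Fin n) ℝ) : Matrix (Fin n) (Fin n ⊕ Fin n) ℝ :=
  Matrix.fromCols 1 (-M)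

/-- The submatrix `A_B` of the columns of `A = [I  -M]` indexed by `B`. -/
def colsA (M : Matrix (Fin n) (Fin n) ℝ) (B : Finset (Fin n ⊕ Fin n)) :
    Matrix (Fin n) B ℝ :=
  (matA M).submatrix id Subtype.val

/-- A basis: `|B| = n` and `rank A_B = n`. -/
def IsBasis (M : Matrix (Fin n) (Fin n) ℝ) (B : Finset (Fin n ⊕ Fin n)) : Prop :=
  B.card = n ∧ (colsA M B).rank = n

/-- A complementary basis: a basis that contains exactly one of each two complementary
indices. -/
def IsComplementaryBasis (M : Matrix (Fin n) (Fin n) ℝ) (B : Finset (Fin n ⊕ Fin n)) : Prop :=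
  IsBasis M B ∧ ∀ i : Fin n, (({Sum.inl i, Sum.inr i} : Finset (Fin n ⊕ Fin n)) ∩ B).card = 1

/-- The cone `C(B)` of all nonnegative combinations of the columns of `A_B`. -/
def cone (M : Matrix (Fin n) (Fin n) ℝ) (B : Finset (Fin n ⊕ Fin n)) : Set (Fin n → ℝ) :=
  {y | ∃ x : B → ℝ, (∀ j, 0 ≤ x j) ∧ (colsA M B).mulVec x = y}

/-- The affine subspace `S = {q + Q θ}`. -/
def affS (Q : Matrix (Fin n) (Fin d) ℝ) (q : Fin n → ℝ) : Set (Fin n → ℝ) :=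
  Set.range fun θ : Fin d → ℝ => q + Q.mulVec θ

/-- The critical domain `S_B = C(B) ∩ S`. -/
def criticalDomain (M : Matrix (Fin n) (Fin n) ℝ) (Q : Matrix (Fin n) (Fin d) ℝ)
    (q : Fin n → ℝ) (B : Finset (Fin n ⊕ Fin n)) : Set (Fin n → ℝ) :=
  cone M B ∩ affS Q q

/-- `S` lies in general position: whenever it meets the cone of a complementary basis, it meets
the interior of that cone. -/
def GeneralPosition (M : Matrix (Fin n) (Fin n) ℝ) (Q : Matrix (Fin n) (Fin d) ℝ)
    (q : Fin n → ℝ) : Prop :=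
  ∀ B : Finset (Fin n ⊕ Fin n), IsComplementaryBasis M B →
    (affS Q q ∩ cone M B).Nonempty → (affS Q q ∩ interior (cone M B)).Nonempty

open Classical in
/-- The dimension of a set, i.e. of its affine hull; the empty set has dimension `-1`. -/
noncomputable def dim (s : Set (Fin n → ℝ)) : ℤ :=
  if s = ∅ then -1 else (Module.finrank ℝ (vectorSpan ℝ s) : ℤ)

/-- The nodes of the critical domain graph: the complementary bases with full-dimensional
critical domain. -/
def Node (M : Matrix (Fin n) (Fin n) ℝ) (Q : Matrix (Fin n) (Fin d) ℝ) (q : Fin n → ℝ) : Type :=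
  {B : Finset (Fin n ⊕ Fin n) // IsComplementaryBasis M B ∧ dim (criticalDomain M Q q B) = d}

/-- The critical domain graph: two distinct nodes are joined if their critical domains are
adjacent, i.e. have a `(d - 1)`-dimensional intersection. -/
def criticalDomainGraph (M : Matrix (Fin n) (Fin n) ℝ) (Q : Matrix (Fin n) (Fin d) ℝ)
    (q : Fin n → ℝ) : SimpleGraph (Node M Q q) where
  Adj B₁ B₂ := B₁ ≠ B₂ ∧
    dim (criticalDomain M Q q B₁.1 ∩ criticalDomain M Q q B₂.1) = (d : ℤ) - 1
  symm := ⟨fun _ _ h => ⟨h.1.symm, by rw [Set.inter_comm]; exact h.2⟩⟩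
  loopless := ⟨fun _ h => h.1 rfl⟩

/-- The set of the parameters `θ` for which the linear complementarity problem with right-hand
side `q + Q θ` has a solution. -/
def feasibleParams (M : Matrix (Fin n) (Fin n) ℝ) (Q : Matrix (Fin n) (Fin d) ℝ)
    (q : Fin n → ℝ) : Set (Fin d → ℝ) :=
  {θ | ∃ w z : Fin n → ℝ, w - M.mulVec z = q + Q.mulVec θ ∧
    (∀ i, 0 ≤ w i) ∧ (∀ i, 0 ≤ z i) ∧ dotProduct w z = 0}

end PLCP

/-! For sufficient `M` the cones of the complementary bases tile a convex set, and codimension-two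
pieces cannot disconnect a convex set.

Tiling. LCP duality (`complementary_alternative`) shows that a feasible LCP is solvable, so every
point of the convex cone spanned by all columns of `[I -M]` lies in a cone of complementary columns.
The rank-deficient ones are negligible, so bases suffice (`complementaryRange_eq_fullCone`). Column
sufficiency makes the interiors disjoint (`eq_of_interior_cone_inter_nonempty`).

Connectivity. Pulled back along `θ ↦ q + Q θ`, the cells of the nodes cover a convex set, general
position making every nonempty cell full-dimensional. If the graph were disconnected, a component
and the rest would meet only in dimension at most `d - 2`, and a generic segment between them would
avoid these intersections (`false_of_codim_two_inter`). -/

open Set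

namespace PLCP

variable {n d : ℕ}

/-! ### LCP duality for sufficient matrices -/

/-- Fredholm alternative. -/
theorem exists_mulVec_eq_or_exists_vecMul_eq_zero {m : ℕ} (N : Matrix (Fin n) (Fin m) ℝ)
    (q : Fin n → ℝ) :
    (∃ x, N.mulVec x = q) ∨ ∃ u : Fin n → ℝ, Matrix.vecMul u N = 0 ∧ u ⬝ᵥ q < 0 := by
  by_cases h : q ∈ LinearMap.range N.mulVecLin
  · obtain ⟨x, hx⟩ := h
    exact Or.inl ⟨x, hx⟩
  · right
    obtain ⟨f, hf, hf'⟩ := Submodule.exists_dual_map_eq_bot_of_notMem h inferInstance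
    have hker : ∀ x, f (N.mulVec x) = 0 := fun x => by
      have hx : f (N.mulVec x) ∈ Submodule.map f (LinearMap.range N.mulVecLin) :=
        ⟨_, ⟨x, rfl⟩, rfl⟩
      rw [hf'] at hx
      simpa using hx
    have hdot : ∀ y, f y = (fun i => f (Pi.single i 1)) ⬝ᵥ y := fun y => by
      rw [f.pi_apply_eq_sum_univ y]
      simp only [dotProduct, smul_eq_mul]
      refine Finset.sum_congr rfl fun i _ => ?_
      rw [mul_comm]
      congr 2
      ext j
      simp [Pi.single_apply, eq_comm]
    refine ⟨(-f q) • fun i => f (Pi.single i 1), ?_, ?_⟩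
    · rw [Matrix.smul_vecMul]
      have h0 : Matrix.vecMul (fun i => f (Pi.single i 1)) N = 0 := by
        refine dotProduct_eq_zero _ fun x => ?_
        rw [← Matrix.dotProduct_mulVec, ← hdot, hker]
      rw [h0, smul_zero]
    · rw [smul_dotProduct, ← hdot, smul_eq_mul]
      have := mul_self_pos.2 hf
      linarith

/-- The LCP duality theorem, relative to a set `s` of indices with sign and complementarity
constraints. For an index outside `s` one variable of the complementary pair vanishes and the
other one is free; `T` says which of them. -/
theorem complementary_alternative {M : Matrix (Fin n) (Fin n) ℝ} (hM : Sufficient M)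
    (q : Fin n → ℝ) (s : Finset (Fin n)) : ∀ T : Finset (Fin n),
    (∃ w z : Fin n → ℝ, w - M.mulVec z = q ∧
      (∀ i ∈ s, 0 ≤ w i ∧ 0 ≤ z i ∧ w i * z i = 0) ∧
      (∀ i ∉ s, (i ∈ T → z i = 0) ∧ (i ∉ T → w i = 0))) ∨
    (∃ u v : Fin n → ℝ, v = -(M.transpose.mulVec u) ∧ u ⬝ᵥ q < 0 ∧
      (∀ i ∈ s, 0 ≤ u i ∧ 0 ≤ v i ∧ u i * v i = 0) ∧
      (∀ i ∉ s, (i ∈ T → u i = 0) ∧ (i ∉ T → v i = 0))) := by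
  induction s using Finset.induction_on with
  | empty =>
    intro T
    rcases exists_mulVec_eq_or_exists_vecMul_eq_zero
      (Matrix.of fun i j => if j ∈ T then (1 : Matrix (Fin n) (Fin n) ℝ) i j else -M i j) q with
      ⟨x, hx⟩ | ⟨u, hu, huq⟩
    · left
      refine ⟨fun i => if i ∈ T then x i else 0, fun i => if i ∈ T then 0 else x i, ?_, by simp,
        fun i _ => ⟨fun h => by simp [h], fun h => by simp [h]⟩⟩
      rw [← hx]
      ext i
      have h1 : (if i ∈ T then x i else 0)
          = ((1 : Matrix (Fin n) (Fin n) ℝ).mulVec fun i => if i ∈ T then x i else 0) i := by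
        rw [Matrix.one_mulVec]
      rw [Pi.sub_apply, h1]
      simp only [Matrix.mulVec, dotProduct, Matrix.of_apply]
      rw [← Finset.sum_sub_distrib]
      refine Finset.sum_congr rfl fun j _ => ?_
      split_ifs <;> ring
    · right
      refine ⟨u, _, rfl, huq, by simp, fun i _ => ⟨fun h => ?_, fun h => ?_⟩⟩
      · have := congrFun hu i
        simpa [Matrix.vecMul, dotProduct, h, Matrix.one_apply] using this
      · have := congrFun hu i
        simpa [Matrix.vecMul, Matrix.mulVec, dotProduct, h, mul_comm] using this
  | insert k s hk ih =>
    -- Release index `k`: the induction hypothesis is used with `k` in `T` and with `k` outside. If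
    -- neither outcome has the right sign at `k`, two primal solutions contradict sufficiency of `M`
    -- via `z - z'`, two dual ones that of the transpose via `u + u'`, and a mixed pair gives `u ⬝ᵥ
    -- q ≥ 0`.
    intro T
    have key : ∀ w z u v : Fin n → ℝ, w - M.mulVec z = q → v = -(M.transpose.mulVec u) →
        u ⬝ᵥ q = ∑ i, (u i * w i + v i * z i) := by
      rintro w z u v rfl rfl
      rw [dotProduct_sub, Matrix.dotProduct_mulVec, ← Matrix.mulVec_transpose,
        Finset.sum_add_distrib, sub_eq_add_neg, ← neg_dotProduct]
      rfl
    have mixed : ∀ w z u v : Fin n → ℝ, w - M.mulVec z = q → v = -(M.transpose.mulVec u) →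
        (∀ i, 0 ≤ u i * w i + v i * z i) → ¬ u ⬝ᵥ q < 0 := fun w z u v h1 h2 h3 => by
      rw [key w z u v h1 h2, not_lt]
      exact Finset.sum_nonneg fun i _ => h3 i
    have hT1 : ∀ i, i ≠ k → (i ∈ insert k T ↔ i ∈ T) := fun i hi => by simp [hi]
    have hT2 : ∀ i, i ≠ k → (i ∈ T.erase k ↔ i ∈ T) := fun i hi => by simp [hi]
    rcases ih (insert k T) with ⟨w, z, hq, hs, hns⟩ | ⟨u, v, hv, huq, hs, hns⟩ <;>
    rcases ih (T.erase k) with ⟨w', z', hq', hs', hns'⟩ | ⟨u', v', hv', huq', hs', hns'⟩ <;>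
    have hk1 := (hns k hk).1 (by simp) <;>
    have hk2 := (hns' k hk).2 (by simp)
    · by_cases h1 : 0 ≤ w k
      · exact Or.inl ⟨w, z, hq, by grind, by grind⟩
      by_cases h2 : 0 ≤ z' k
      · exact Or.inl ⟨w', z', hq', by grind, by grind⟩
      exfalso
      have hd : M.mulVec (z - z') = w - w' := by
        rw [Matrix.mulVec_sub]
        have := hq.trans hq'.symm
        ext i
        have := congrFun this i
        simp only [Pi.sub_apply] at this ⊢
        linarith
      have hle : ∀ i, (z - z') i * (M.mulVec (z - z')) i ≤ 0 := fun i => by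
        rw [hd]
        simp only [Pi.sub_apply]
        by_cases hik : i = k
        · subst hik
          rw [hk1, hk2]
          nlinarith
        by_cases his : i ∈ s
        · obtain ⟨a, b, c⟩ := hs i his
          obtain ⟨a', b', c'⟩ := hs' i his
          nlinarith [mul_nonneg a b', mul_nonneg a' b]
        · have e1 := hns i his
          have e2 := hns' i his
          rw [hT1 i hik] at e1
          rw [hT2 i hik] at e2
          by_cases hiT : i ∈ T
          · simp [e1.1 hiT, e2.1 hiT]
          · simp [e1.2 hiT, e2.2 hiT]
      have := hM.1 _ hle k
      rw [hd] at this
      simp only [Pi.sub_apply, hk1, hk2] at this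
      nlinarith
    · by_cases h1 : 0 ≤ w k
      · exact Or.inl ⟨w, z, hq, by grind, by grind⟩
      by_cases h2 : 0 ≤ u' k
      · exact Or.inr ⟨u', v', hv', huq', by grind, by grind⟩
      exfalso
      refine mixed w z u' v' hq hv' (fun i => ?_) huq'
      by_cases hik : i = k
      · subst hik
        rw [hk1, hk2]
        nlinarith
      by_cases his : i ∈ s
      · obtain ⟨a, b, c⟩ := hs i his
        obtain ⟨a', b', c'⟩ := hs' i his
        positivity
      · have e1 := hns i his
        have e2 := hns' i his
        rw [hT1 i hik] at e1
        rw [hT2 i hik] at e2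
        by_cases hiT : i ∈ T
        · simp [e1.1 hiT, e2.1 hiT]
        · simp [e1.2 hiT, e2.2 hiT]
    · by_cases h1 : 0 ≤ v k
      · exact Or.inr ⟨u, v, hv, huq, by grind, by grind⟩
      by_cases h2 : 0 ≤ z' k
      · exact Or.inl ⟨w', z', hq', by grind, by grind⟩
      exfalso
      refine mixed w' z' u v hq' hv (fun i => ?_) huq
      by_cases hik : i = k
      · subst hik
        rw [hk1, hk2]
        nlinarith
      by_cases his : i ∈ s
      · obtain ⟨a, b, c⟩ := hs i his
        obtain ⟨a', b', c'⟩ := hs' i his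
        positivity
      · have e1 := hns i his
        have e2 := hns' i his
        rw [hT1 i hik] at e1
        rw [hT2 i hik] at e2
        by_cases hiT : i ∈ T
        · simp [e1.1 hiT, e2.1 hiT]
        · simp [e1.2 hiT, e2.2 hiT]
    · by_cases h1 : 0 ≤ v k
      · exact Or.inr ⟨u, v, hv, huq, by grind, by grind⟩
      by_cases h2 : 0 ≤ u' k
      · exact Or.inr ⟨u', v', hv', huq', by grind, by grind⟩
      exfalso
      have hd : M.transpose.mulVec (u + u') = -(v + v') := by
        rw [Matrix.mulVec_add, hv, hv']
        abel
      have hle : ∀ i, (u + u') i * (M.transpose.mulVec (u + u')) i ≤ 0 := fun i => by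
        rw [hd]
        simp only [Pi.add_apply, Pi.neg_apply]
        by_cases hik : i = k
        · subst hik
          rw [hk1, hk2]
          nlinarith
        by_cases his : i ∈ s
        · obtain ⟨a, b, c⟩ := hs i his
          obtain ⟨a', b', c'⟩ := hs' i his
          nlinarith [mul_nonneg a b', mul_nonneg a' b]
        · have e1 := hns i his
          have e2 := hns' i his
          rw [hT1 i hik] at e1
          rw [hT2 i hik] at e2
          by_cases hiT : i ∈ T
          · simp [e1.1 hiT, e2.1 hiT]
          · simp [e1.2 hiT, e2.2 hiT]
      have := hM.2 _ hle k
      rw [hd] at this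
      simp only [Pi.add_apply, Pi.neg_apply, hk1, hk2] at this
      nlinarith

/-- A feasible linear complementarity problem with a sufficient matrix is solvable. -/
theorem exists_complementary_solution {M : Matrix (Fin n) (Fin n) ℝ} (hM : Sufficient M)
    {w z : Fin n → ℝ} (hw : 0 ≤ w) (hz : 0 ≤ z) :
    ∃ w' z' : Fin n → ℝ, w' - M.mulVec z' = w - M.mulVec z ∧
      ∀ i, 0 ≤ w' i ∧ 0 ≤ z' i ∧ w' i * z' i = 0 := by
  rcases complementary_alternative hM (w - M.mulVec z) Finset.univ ∅ with
    ⟨w', z', h, h', -⟩ | ⟨u, v, rfl, h, h', -⟩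
  · exact ⟨w', z', h, fun i => h' i (Finset.mem_univ i)⟩
  · exfalso
    rw [dotProduct_sub, Matrix.dotProduct_mulVec, ← Matrix.mulVec_transpose, sub_eq_add_neg,
      ← neg_dotProduct] at h
    have h1 : 0 ≤ u ⬝ᵥ w :=
      dotProduct_nonneg_of_nonneg (fun i => (h' i (Finset.mem_univ i)).1) hw
    have h2 : 0 ≤ (-(M.transpose.mulVec u)) ⬝ᵥ z :=
      dotProduct_nonneg_of_nonneg (fun i => (h' i (Finset.mem_univ i)).2.1) hz
    linarith


/-! ### Cones of complementary bases -/

/-- Extension by zero of a vector indexed by `B` to all column indices. -/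
noncomputable def extendZero {B : Finset (Fin n ⊕ Fin n)} (x : B → ℝ) (j : Fin n ⊕ Fin n) : ℝ :=
  if h : j ∈ B then x ⟨j, h⟩ else 0

theorem extendZero_of_mem {B : Finset (Fin n ⊕ Fin n)} (x : B → ℝ) {j : Fin n ⊕ Fin n}
    (h : j ∈ B) : extendZero x j = x ⟨j, h⟩ := dif_pos h

theorem extendZero_of_notMem {B : Finset (Fin n ⊕ Fin n)} (x : B → ℝ) {j : Fin n ⊕ Fin n}
    (h : j ∉ B) : extendZero x j = 0 := dif_neg h

theorem extendZero_nonneg {B : Finset (Fin n ⊕ Fin n)} {x : B → ℝ} (hx : ∀ j, 0 ≤ x j)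
    (j : Fin n ⊕ Fin n) : 0 ≤ extendZero x j := by
  unfold extendZero
  split_ifs
  exacts [hx _, le_rfl]

theorem matA_mulVec (M : Matrix (Fin n) (Fin n) ℝ) (y : Fin n ⊕ Fin n → ℝ) :
    (matA M).mulVec y = (fun i => y (Sum.inl i)) - M.mulVec fun i => y (Sum.inr i) := by
  rw [matA, Matrix.fromCols_mulVec, Matrix.one_mulVec, Matrix.neg_mulVec, sub_eq_add_neg]
  rfl

theorem colsA_mulVec_of_eq_zero (M : Matrix (Fin n) (Fin n) ℝ) {B : Finset (Fin n ⊕ Fin n)}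
    {y : Fin n ⊕ Fin n → ℝ} (hy : ∀ j ∉ B, y j = 0) :
    (colsA M B).mulVec (fun j => y j) = (matA M).mulVec y := by
  ext i
  simp only [Matrix.mulVec, dotProduct, colsA, Matrix.submatrix_apply, id]
  rw [Finset.sum_coe_sort B fun j => matA M i j * y j]
  exact Finset.sum_subset (Finset.subset_univ B) fun j _ hj => by rw [hy j hj, mul_zero]

theorem colsA_mulVec (M : Matrix (Fin n) (Fin n) ℝ) {B : Finset (Fin n ⊕ Fin n)} (x : B → ℝ) :
    (colsA M B).mulVec x = (fun i => extendZero x (Sum.inl i)) -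
      M.mulVec fun i => extendZero x (Sum.inr i) := by
  rw [← matA_mulVec, ← colsA_mulVec_of_eq_zero M fun j hj => extendZero_of_notMem x hj]
  congr 1
  ext j
  rw [extendZero_of_mem x j.2]

theorem cone_eq_image (M : Matrix (Fin n) (Fin n) ℝ) (B : Finset (Fin n ⊕ Fin n)) :
    cone M B = (colsA M B).mulVecLin '' Ici 0 := rfl

theorem convex_cone (M : Matrix (Fin n) (Fin n) ℝ) (B : Finset (Fin n ⊕ Fin n)) :
    Convex ℝ (cone M B) := by
  rw [cone_eq_image]
  exact (convex_Ici 0).linear_image _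

theorem IsBasis.isClosed_cone {M : Matrix (Fin n) (Fin n) ℝ} {B : Finset (Fin n ⊕ Fin n)}
    (hB : IsBasis M B) : IsClosed (cone M B) := by
  rw [cone_eq_image]
  refine (LinearMap.isClosedEmbedding_of_injective ?_).isClosedMap _ isClosed_Ici
  have h := (colsA M B).mulVecLin.finrank_range_add_finrank_ker
  have h1 : Module.finrank ℝ (LinearMap.range (colsA M B).mulVecLin) = n := hB.2
  rw [h1, Module.finrank_fintype_fun_eq_card, Fintype.card_coe, hB.1] at h
  exact Submodule.finrank_eq_zero.1 (by omega)

theorem cone_subset_range (M : Matrix (Fin n) (Fin n) ℝ) (B : Finset (Fin n ⊕ Fin n)) :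
    cone M B ⊆ LinearMap.range (colsA M B).mulVecLin := by
  rintro _ ⟨x, -, rfl⟩
  exact ⟨x, rfl⟩

/-- Subtracting a small positive multiple of the sum of the columns stays in the cone; adding it
back makes all coefficients positive. -/
theorem exists_pos_of_mem_interior_cone {M : Matrix (Fin n) (Fin n) ℝ}
    {B : Finset (Fin n ⊕ Fin n)} {y : Fin n → ℝ} (hy : y ∈ interior (cone M B)) :
    ∃ x : B → ℝ, (∀ j, 0 < x j) ∧ (colsA M B).mulVec x = y := by
  have hc : Continuous fun ε : ℝ => y - ε • (colsA M B).mulVec 1 := by fun_prop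
  have hn : ∀ᶠ ε : ℝ in nhds 0, y - ε • (colsA M B).mulVec 1 ∈ cone M B := by
    refine hc.continuousAt.eventually_mem ?_
    simpa using mem_interior_iff_mem_nhds.1 hy
  obtain ⟨ε, hε, hpos⟩ :=
    ((hn.filter_mono nhdsWithin_le_nhds).and (self_mem_nhdsWithin (s := Ioi (0 : ℝ)))).exists
  obtain ⟨x, hx, hxy⟩ := hε
  refine ⟨x + ε • 1, fun j => ?_, ?_⟩
  · have := hx j
    have : 0 < ε := hpos
    simp only [Pi.add_apply, Pi.smul_apply, Pi.one_apply, smul_eq_mul]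
    linarith
  · rw [Matrix.mulVec_add, hxy, Matrix.mulVec_smul]
    abel

theorem IsComplementaryBasis.inl_mem_iff {M : Matrix (Fin n) (Fin n) ℝ}
    {B : Finset (Fin n ⊕ Fin n)} (hB : IsComplementaryBasis M B) (i : Fin n) :
    Sum.inl i ∈ B ↔ Sum.inr i ∉ B := by
  have h := hB.2 i
  by_cases h1 : Sum.inl i ∈ B <;> by_cases h2 : Sum.inr i ∈ B <;>
    simp [h1, h2, Finset.insert_inter_of_mem, Finset.insert_inter_of_notMem] at h ⊢

/-- For two complementary representations of `y`, the difference of the `z`-parts has products `-(w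
z' + w' z) ≤ 0`. Column sufficiency makes these cross terms vanish, while an index in `B` but not in
`B'` would make one positive. -/
theorem subset_of_interior_cone_inter_nonempty {M : Matrix (Fin n) (Fin n) ℝ}
    (hM : ColumnSufficient M) {B B' : Finset (Fin n ⊕ Fin n)} (hB : IsComplementaryBasis M B)
    (hB' : IsComplementaryBasis M B') {y : Fin n → ℝ} (hy : y ∈ interior (cone M B))
    (hy' : y ∈ interior (cone M B')) : B ⊆ B' := by
  obtain ⟨x, hx, hxy⟩ := exists_pos_of_mem_interior_cone hy
  obtain ⟨x', hx', hxy'⟩ := exists_pos_of_mem_interior_cone hy'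
  set e := extendZero x with he
  set e' := extendZero x' with he'
  have hn : ∀ j, 0 ≤ e j := extendZero_nonneg fun j => (hx j).le
  have hn' : ∀ j, 0 ≤ e' j := extendZero_nonneg fun j => (hx' j).le
  have hp : ∀ j ∈ B, 0 < e j := fun j hj => by rw [he, extendZero_of_mem x hj]; exact hx _
  have hp' : ∀ j ∈ B', 0 < e' j := fun j hj => by rw [he', extendZero_of_mem x' hj]; exact hx' _
  have hc : ∀ i, e (Sum.inl i) * e (Sum.inr i) = 0 := fun i => by
    by_cases h : Sum.inl i ∈ B
    · rw [he, extendZero_of_notMem x ((hB.inl_mem_iff i).1 h), mul_zero]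
    · rw [he, extendZero_of_notMem x h, zero_mul]
  have hc' : ∀ i, e' (Sum.inl i) * e' (Sum.inr i) = 0 := fun i => by
    by_cases h : Sum.inl i ∈ B'
    · rw [he', extendZero_of_notMem x' ((hB'.inl_mem_iff i).1 h), mul_zero]
    · rw [he', extendZero_of_notMem x' h, zero_mul]
  have hd : M.mulVec ((fun i => e (Sum.inr i)) - fun i => e' (Sum.inr i)) =
      (fun i => e (Sum.inl i)) - fun i => e' (Sum.inl i) := by
    have h := hxy.trans hxy'.symm
    rw [colsA_mulVec, colsA_mulVec] at h
    rw [Matrix.mulVec_sub]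
    ext i
    have := congrFun h i
    simp only [Pi.sub_apply] at this ⊢
    linarith
  have hz : ∀ i, e (Sum.inl i) * e' (Sum.inr i) + e' (Sum.inl i) * e (Sum.inr i) = 0 := by
    have h := hM ((fun i => e (Sum.inr i)) - fun i => e' (Sum.inr i)) fun i => by
      rw [hd]
      simp only [Pi.sub_apply]
      nlinarith [hc i, hc' i, mul_nonneg (hn (Sum.inl i)) (hn' (Sum.inr i)),
        mul_nonneg (hn' (Sum.inl i)) (hn (Sum.inr i))]
    intro i
    have := h i
    rw [hd] at this
    simp only [Pi.sub_apply] at this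
    linarith [hc i, hc' i]
  rintro (i | i) hi
  · by_contra hi'
    have h2 : Sum.inr i ∈ B' := by
      by_contra h
      exact hi' ((hB'.inl_mem_iff i).2 h)
    linarith [hz i, mul_pos (hp _ hi) (hp' _ h2),
      mul_nonneg (hn' (Sum.inl i)) (hn (Sum.inr i))]
  · by_contra hi'
    have h2 : Sum.inl i ∈ B' := (hB'.inl_mem_iff i).2 hi'
    linarith [hz i, mul_pos (hp' _ h2) (hp _ hi),
      mul_nonneg (hn (Sum.inl i)) (hn' (Sum.inr i))]

/-- The interiors of the cones of distinct complementary bases are disjoint. -/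
theorem eq_of_interior_cone_inter_nonempty {M : Matrix (Fin n) (Fin n) ℝ}
    (hM : ColumnSufficient M) {B B' : Finset (Fin n ⊕ Fin n)} (hB : IsComplementaryBasis M B)
    (hB' : IsComplementaryBasis M B') {y : Fin n → ℝ} (hy : y ∈ interior (cone M B))
    (hy' : y ∈ interior (cone M B')) : B = B' :=
  (subset_of_interior_cone_inter_nonempty hM hB hB' hy hy').antisymm
    (subset_of_interior_cone_inter_nonempty hM hB' hB hy' hy)

/-! ### Covering the full cone by complementary cones -/

/-- The cone generated by all columns of `[I  -M]`. -/
def fullCone (M : Matrix (Fin n) (Fin n) ℝ) : Set (Fin n → ℝ) :=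
  (matA M).mulVecLin '' Ici 0

theorem convex_fullCone (M : Matrix (Fin n) (Fin n) ℝ) : Convex ℝ (fullCone M) :=
  (convex_Ici 0).linear_image _

theorem mem_fullCone {M : Matrix (Fin n) (Fin n) ℝ} {w z : Fin n → ℝ} (hw : 0 ≤ w)
    (hz : 0 ≤ z) : w - M.mulVec z ∈ fullCone M := by
  refine ⟨Sum.elim w z, ?_, ?_⟩
  · rintro (i | i)
    exacts [hw i, hz i]
  · rw [Matrix.mulVecLin_apply, matA_mulVec]
    rfl

theorem cone_subset_fullCone (M : Matrix (Fin n) (Fin n) ℝ) (B : Finset (Fin n ⊕ Fin n)) :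
    cone M B ⊆ fullCone M := by
  rintro _ ⟨x, hx, rfl⟩
  rw [colsA_mulVec]
  exact mem_fullCone (fun i => extendZero_nonneg hx _) (fun i => extendZero_nonneg hx _)

theorem interior_fullCone_nonempty (M : Matrix (Fin n) (Fin n) ℝ) :
    (interior (fullCone M)).Nonempty := by
  refine ⟨1, mem_interior.2 ⟨{y | ∀ i, 0 < y i}, fun y hy => ?_, ?_, by simp⟩⟩
  · simpa using mem_fullCone (M := M) (w := y) (z := 0) (fun i => (hy i).le) le_rfl
  · simp only [ofPred_forall]
    exact isOpen_iInter_of_finite fun i => isOpen_lt continuous_const (continuous_apply i)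

/-- The union of the cones of the complementary bases. -/
def complementaryRange (M : Matrix (Fin n) (Fin n) ℝ) : Set (Fin n → ℝ) :=
  ⋃ B ∈ {B | IsComplementaryBasis M B}, cone M B

theorem isClosed_complementaryRange (M : Matrix (Fin n) (Fin n) ℝ) :
    IsClosed (complementaryRange M) :=
  (toFinite _).isClosed_biUnion fun _ hB => hB.1.isClosed_cone

theorem exists_mem_cone_of_mem_fullCone {M : Matrix (Fin n) (Fin n) ℝ} (hM : Sufficient M)
    {y : Fin n → ℝ} (hy : y ∈ fullCone M) :
    ∃ B : Finset (Fin n ⊕ Fin n), y ∈ cone M B ∧ B.card = n ∧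
      ∀ i : Fin n, (({Sum.inl i, Sum.inr i} : Finset (Fin n ⊕ Fin n)) ∩ B).card = 1 := by
  obtain ⟨x, hx, rfl⟩ := hy
  obtain ⟨w, z, h, h'⟩ := exists_complementary_solution hM
    (w := fun i => x (Sum.inl i)) (z := fun i => x (Sum.inr i)) (fun i => hx _) (fun i => hx _)
  rw [Matrix.mulVecLin_apply, matA_mulVec, ← h]
  classical
  set T : Finset (Fin n) := Finset.univ.filter fun i => 0 < w i with hT
  refine ⟨T.disjSum Tᶜ, ⟨fun j => Sum.elim w z j, ?_, ?_⟩, ?_, fun i => ?_⟩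
  · rintro ⟨j | j, -⟩
    exacts [(h' j).1, (h' j).2.1]
  · rw [colsA_mulVec_of_eq_zero, matA_mulVec]
    · rfl
    · rintro (j | j) hj
      · have : ¬ 0 < w j := by simpa [hT] using hj
        exact le_antisymm (not_lt.1 this) (h' j).1
      · have : 0 < w j := by simpa [hT] using hj
        exact (mul_eq_zero.1 (h' j).2.2).resolve_left this.ne'
  · rw [Finset.card_disjSum, Finset.card_add_card_compl, Fintype.card_fin]
  · by_cases hi : i ∈ T <;>
      simp [hi, Finset.insert_inter_of_mem, Finset.insert_inter_of_notMem]

/-- Interior points missed by the bases form an open set inside finitely many proper subspaces,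
hence a null, hence an empty set. Closedness of the union extends the covering to the boundary. -/
theorem complementaryRange_eq_fullCone {M : Matrix (Fin n) (Fin n) ℝ} (hM : Sufficient M) :
    complementaryRange M = fullCone M := by
  refine Subset.antisymm (iUnion₂_subset fun B _ => cone_subset_fullCone M B) ?_
  have hdiff : interior (fullCone M) \ complementaryRange M = ∅ := by
    have hopen := isOpen_interior (s := fullCone M) |>.sdiff (isClosed_complementaryRange M)
    rw [← hopen.measure_eq_zero_iff (μ := MeasureTheory.volume)]
    refine MeasureTheory.measure_mono_null (t := ⋃ B ∈ {B : Finset (Fin n ⊕ Fin n) |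
      LinearMap.range (colsA M B).mulVecLin ≠ ⊤},
        (LinearMap.range (colsA M B).mulVecLin : Set (Fin n → ℝ))) ?_ ?_
    · rintro y ⟨hy, hy'⟩
      obtain ⟨B, hyB, hcard, hB⟩ := exists_mem_cone_of_mem_fullCone hM (interior_subset hy)
      refine mem_biUnion (fun htop => hy' ?_) (cone_subset_range M B hyB)
      refine mem_biUnion (show IsComplementaryBasis M B from ⟨⟨hcard, ?_⟩, hB⟩) hyB
      rw [Matrix.rank, htop, finrank_top, Module.finrank_fin_fun]
    · exact (MeasureTheory.measure_biUnion_null_iff (toFinite _).countable).2 fun B hB =>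
        MeasureTheory.Measure.addHaar_submodule _ _ hB
  calc fullCone M ⊆ closure (fullCone M) := subset_closure
    _ = closure (interior (fullCone M)) :=
      ((convex_fullCone M).closure_interior_eq_closure_of_nonempty_interior
        (interior_fullCone_nonempty M)).symm
    _ ⊆ complementaryRange M :=
      closure_minimal (sdiff_eq_empty.1 hdiff) (isClosed_complementaryRange M)


/-! ### Critical domains in parameter space -/

/-- The parametrization `θ ↦ q + Q θ` of `S`. -/
noncomputable def paramMap (Q : Matrix (Fin n) (Fin d) ℝ) (q : Fin n → ℝ) :
    (Fin d → ℝ) →ᵃ[ℝ] (Fin n → ℝ) :=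
  Q.mulVecLin.toAffineMap + AffineMap.const ℝ _ q

theorem paramMap_apply (Q : Matrix (Fin n) (Fin d) ℝ) (q : Fin n → ℝ) (θ : Fin d → ℝ) :
    paramMap Q q θ = q + Q.mulVec θ := add_comm _ _

theorem paramMap_linear (Q : Matrix (Fin n) (Fin d) ℝ) (q : Fin n → ℝ) :
    (paramMap Q q).linear = Q.mulVecLin := by
  ext
  simp [paramMap]

theorem continuous_paramMap (Q : Matrix (Fin n) (Fin d) ℝ) (q : Fin n → ℝ) :
    Continuous (paramMap Q q) := (paramMap Q q).continuous_of_finiteDimensional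

theorem range_paramMap (Q : Matrix (Fin n) (Fin d) ℝ) (q : Fin n → ℝ) :
    range (paramMap Q q) = affS Q q := by
  rw [affS]
  congr 1
  ext θ : 1
  exact paramMap_apply Q q θ

theorem mulVecLin_injective_of_rank_eq {Q : Matrix (Fin n) (Fin d) ℝ} (hQ : Q.rank = d) :
    Function.Injective Q.mulVecLin := by
  rw [← LinearMap.ker_eq_bot]
  have h := Q.mulVecLin.finrank_range_add_finrank_ker
  have h1 : Module.finrank ℝ (LinearMap.range Q.mulVecLin) = d := hQ
  rw [h1, Module.finrank_fin_fun] at h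
  exact Submodule.finrank_eq_zero.1 (by omega)

theorem dim_image_paramMap {Q : Matrix (Fin n) (Fin d) ℝ} (hQ : Q.rank = d) (q : Fin n → ℝ)
    (s : Set (Fin d → ℝ)) : dim (paramMap Q q '' s) = dim s := by
  unfold dim
  simp only [image_eq_empty]
  rw [← AffineMap.map_vectorSpan, paramMap_linear,
    ← (Submodule.equivMapOfInjective _ (mulVecLin_injective_of_rank_eq hQ) _).finrank_eq]

theorem dim_eq_of_interior_nonempty {s : Set (Fin d → ℝ)} (hs : (interior s).Nonempty) :
    dim s = d := by
  rw [dim, if_neg (hs.mono interior_subset).ne_empty,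
    AffineSubspace.vectorSpan_eq_top_of_affineSpan_eq_top ℝ _ _
      (affineSpan_eq_top_of_nonempty_interior
        (hs.mono (interior_mono (subset_convexHull ℝ s)))), finrank_top, Module.finrank_fin_fun]

theorem interior_nonempty_of_dim_eq {s : Set (Fin d → ℝ)} (hc : Convex ℝ s) (hs : dim s = d) :
    (interior s).Nonempty := by
  unfold dim at hs
  split_ifs at hs with h
  rw [hc.interior_nonempty_iff_affineSpan_eq_top,
    AffineSubspace.affineSpan_eq_top_iff_vectorSpan_eq_top_of_nonempty ℝ _ _
      (nonempty_iff_ne_empty.2 h)]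
  exact Submodule.eq_top_of_finrank_eq (by rw [Module.finrank_fin_fun]; exact_mod_cast hs)

/-- The critical domain of `B` in parameter space. -/
def paramCell (M : Matrix (Fin n) (Fin n) ℝ) (Q : Matrix (Fin n) (Fin d) ℝ) (q : Fin n → ℝ)
    (B : Finset (Fin n ⊕ Fin n)) : Set (Fin d → ℝ) :=
  paramMap Q q ⁻¹' cone M B

variable {M : Matrix (Fin n) (Fin n) ℝ} {Q : Matrix (Fin n) (Fin d) ℝ} {q : Fin n → ℝ}
  {B B' : Finset (Fin n ⊕ Fin n)}

theorem convex_paramCell : Convex ℝ (paramCell M Q q B) :=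
  (convex_cone M B).affine_preimage _

theorem IsBasis.isClosed_paramCell (hB : IsBasis M B) : IsClosed (paramCell M Q q B) :=
  hB.isClosed_cone.preimage (continuous_paramMap Q q)

theorem dim_criticalDomain (hQ : Q.rank = d) :
    dim (criticalDomain M Q q B) = dim (paramCell M Q q B) := by
  rw [← dim_image_paramMap hQ q, paramCell, image_preimage_eq_inter_range, range_paramMap]
  rfl

theorem dim_criticalDomain_inter (hQ : Q.rank = d) :
    dim (criticalDomain M Q q B ∩ criticalDomain M Q q B') =
      dim (paramCell M Q q B ∩ paramCell M Q q B') := by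
  rw [← dim_image_paramMap hQ q, paramCell, paramCell, ← preimage_inter,
    image_preimage_eq_inter_range, range_paramMap, inter_inter_distrib_right]
  rfl

theorem GeneralPosition.nonempty (hS : GeneralPosition M Q q) (hB : IsComplementaryBasis M B)
    (h : (paramCell M Q q B).Nonempty) : (paramMap Q q ⁻¹' interior (cone M B)).Nonempty := by
  obtain ⟨θ, hθ⟩ := h
  obtain ⟨_, h1, h2⟩ := hS B hB ⟨_, range_paramMap Q q ▸ mem_range_self θ, hθ⟩
  rw [← range_paramMap] at h1
  obtain ⟨η, rfl⟩ := h1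
  exact ⟨η, h2⟩

theorem GeneralPosition.dim_eq (hS : GeneralPosition M Q q) (hQ : Q.rank = d)
    (hB : IsComplementaryBasis M B) (h : (paramCell M Q q B).Nonempty) :
    dim (criticalDomain M Q q B) = d := by
  rw [dim_criticalDomain hQ]
  exact dim_eq_of_interior_nonempty ((hS.nonempty hB h).mono
    (preimage_interior_subset_interior_preimage (continuous_paramMap Q q)))

/-- Open segments from a point of the cell towards one mapped into the interior of the cone stay in
the preimage of that interior. -/
theorem GeneralPosition.subset_closure (hS : GeneralPosition M Q q)
    (hB : IsComplementaryBasis M B) :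
    paramCell M Q q B ⊆ closure (paramMap Q q ⁻¹' interior (cone M B)) := by
  intro θ hθ
  obtain ⟨η, hη⟩ := hS.nonempty hB ⟨θ, hθ⟩
  refine closure_mono ?_ (segment_subset_closure_openSegment (left_mem_segment ℝ θ η))
  rw [← image_subset_iff, image_openSegment]
  exact (convex_cone M B).openSegment_self_interior_subset_interior hθ hη

/-- In an open set common to both cells, two successive perturbations reach a parameter mapped into
both cone interiors. -/
theorem GeneralPosition.eq_of_dim_inter_eq (hS : GeneralPosition M Q q) (hM : ColumnSufficient M)
    (hB : IsComplementaryBasis M B) (hB' : IsComplementaryBasis M B')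
    (h : dim (paramCell M Q q B ∩ paramCell M Q q B') = d) : B = B' := by
  obtain ⟨θ, hθ⟩ := interior_nonempty_of_dim_eq (convex_paramCell.inter convex_paramCell) h
  have hcont := continuous_paramMap Q q
  obtain ⟨η, h1, h2⟩ := mem_closure_iff.1
    (hS.subset_closure hB (interior_subset hθ).1) _ isOpen_interior hθ
  obtain ⟨ζ, ⟨-, h3⟩, h4⟩ := mem_closure_iff.1
    (hS.subset_closure hB' (interior_subset h1).2) _
    (isOpen_interior.inter (isOpen_interior.preimage hcont)) ⟨h1, h2⟩
  exact eq_of_interior_cone_inter_nonempty hM hB hB' h3 h4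

/-! ### Codimension two does not separate -/

/-- The affine hull of a point and a set of codimension at least two has measure zero. -/
theorem volume_affineSpan_insert_eq_zero {s : Set (Fin d → ℝ)} (hs : dim s < (d : ℤ) - 1)
    (p : Fin d → ℝ) : MeasureTheory.volume (affineSpan ℝ (insert p s) : Set (Fin d → ℝ)) = 0 := by
  refine MeasureTheory.Measure.addHaar_affineSubspace _ _ fun htop => ?_
  have h1 := AffineSubspace.vectorSpan_eq_top_of_affineSpan_eq_top ℝ _ _ htop
  have h2 := finrank_vectorSpan_insert_le_set ℝ s p
  rw [h1, finrank_top, Module.finrank_fin_fun] at h2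
  unfold dim at hs
  split_ifs at hs with h
  -- Here `-1 < d - 1` gives `d > 0`, so a single point cannot span the space.
  · subst h
    rw [vectorSpan_empty, finrank_bot] at h2
    rw [insert_empty_eq, vectorSpan_singleton] at h1
    have h3 := congrArg (fun V : Submodule ℝ (Fin d → ℝ) => Module.finrank ℝ V) h1
    simp only [finrank_bot, finrank_top, Module.finrank_fin_fun] at h3
    omega
  · omega

theorem dim_le (s : Set (Fin d → ℝ)) : dim s ≤ d := by
  unfold dim
  split_ifs
  · omega
  · have := Submodule.finrank_le (vectorSpan ℝ s)
    rw [Module.finrank_fin_fun] at this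
    exact_mod_cast this

theorem exists_mem_of_isOpen_of_measure_eq_zero {U N : Set (Fin d → ℝ)} (hU : IsOpen U)
    (hne : U.Nonempty) (hN : MeasureTheory.volume N = 0) : ∃ x ∈ U, x ∉ N := by
  by_contra! h
  exact (hU.measure_pos MeasureTheory.volume hne).ne'
    (MeasureTheory.measure_mono_null h hN)

/-- Two families of closed sets covering a convex set, such that members of different families
meet in codimension at least two, cannot both contain a set with nonempty interior. -/
theorem false_of_codim_two_inter {ι κ : Type*} [Finite ι] [Finite κ] {X : ι → Set (Fin d → ℝ)}
    {Y : κ → Set (Fin d → ℝ)} (hX : ∀ i, IsClosed (X i)) (hY : ∀ k, IsClosed (Y k))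
    (hc : Convex ℝ ((⋃ i, X i) ∪ ⋃ k, Y k)) (hXY : ∀ i k, dim (X i ∩ Y k) < (d : ℤ) - 1)
    {i₀ : ι} {k₀ : κ} (hi₀ : (interior (X i₀)).Nonempty) (hk₀ : (interior (Y k₀)).Nonempty) :
    False := by
  -- Pick `p` off all intersections, then `r` off their affine hulls with `p`. By connectedness the
  -- segment from `p` to `r` meets some `X i ∩ Y k` at `x ≠ p`, and the line through `p` and `x`
  -- puts `r` in a forbidden hull.
  obtain ⟨p, hp, hpN⟩ := exists_mem_of_isOpen_of_measure_eq_zero isOpen_interior hi₀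
    (N := ⋃ a : ι × κ, X a.1 ∩ Y a.2) (MeasureTheory.measure_iUnion_null fun a =>
      MeasureTheory.measure_mono_null ((subset_insert 0 _).trans (subset_affineSpan ℝ _))
        (volume_affineSpan_insert_eq_zero (hXY a.1 a.2) 0))
  obtain ⟨r, hr, hrN⟩ := exists_mem_of_isOpen_of_measure_eq_zero isOpen_interior hk₀
    (N := ⋃ a : ι × κ, (affineSpan ℝ (insert p (X a.1 ∩ Y a.2)) : Set (Fin d → ℝ)))
    (MeasureTheory.measure_iUnion_null fun a => volume_affineSpan_insert_eq_zero (hXY a.1 a.2) p)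
  have hpX : p ∈ ⋃ i, X i := mem_iUnion_of_mem i₀ (interior_subset hp)
  have hrY : r ∈ ⋃ k, Y k := mem_iUnion_of_mem k₀ (interior_subset hr)
  obtain ⟨x, hx, hxX, hxY⟩ := isPreconnected_closed_iff.1 (convex_segment p r).isPreconnected
    _ _ (isClosed_iUnion_of_finite hX) (isClosed_iUnion_of_finite hY)
    (hc.segment_subset (Or.inl hpX) (Or.inr hrY)) ⟨p, left_mem_segment ℝ p r, hpX⟩
    ⟨r, right_mem_segment ℝ p r, hrY⟩
  obtain ⟨i, hi⟩ := mem_iUnion.1 hxX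
  obtain ⟨k, hk⟩ := mem_iUnion.1 hxY
  have hxp : x ≠ p := by
    rintro rfl
    exact hpN (mem_iUnion_of_mem (i, k) ⟨hi, hk⟩)
  refine hrN (mem_iUnion_of_mem (i, k) ?_)
  rw [segment_eq_image_lineMap] at hx
  obtain ⟨t, -, rfl⟩ := hx
  have ht : t ≠ 0 := by
    rintro rfl
    simp at hxp
  have hmem := AffineMap.lineMap_mem t⁻¹
    (subset_affineSpan ℝ _ (mem_insert p (X i ∩ Y k)))
    (subset_affineSpan ℝ _ (mem_insert_of_mem p (show _ ∈ X i ∩ Y k from ⟨hi, hk⟩)))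
  rwa [AffineMap.lineMap_lineMap_right, inv_mul_cancel₀ ht, AffineMap.lineMap_apply_one] at hmem

/-! ### Connectedness of the critical domain graph -/

theorem GeneralPosition.preconnected_criticalDomainGraph (hS : GeneralPosition M Q q)
    (hM : Sufficient M) (hQ : Q.rank = d) : (criticalDomainGraph M Q q).Preconnected := by
  intro B₁ B₂
  by_contra hnot
  have hfin : Finite (Node M Q q) := inferInstanceAs (Finite (Subtype _))
  have hint : ∀ B : Node M Q q, (interior (paramCell M Q q B.1)).Nonempty := fun B =>
    interior_nonempty_of_dim_eq convex_paramCell ((dim_criticalDomain hQ).symm.trans B.2.2)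
  refine false_of_codim_two_inter
    (X := fun B : {B // (criticalDomainGraph M Q q).Reachable B₁ B} => paramCell M Q q B.1.1)
    (Y := fun B : {B // ¬ (criticalDomainGraph M Q q).Reachable B₁ B} => paramCell M Q q B.1.1)
    (fun B => B.1.2.1.1.isClosed_paramCell) (fun B => B.1.2.1.1.isClosed_paramCell) ?_ ?_
    (i₀ := ⟨B₁, .rfl⟩) (k₀ := ⟨B₂, hnot⟩) (hint B₁) (hint B₂)
  -- The two unions together are the preimage of the full cone, since a basis with a nonempty cell
  -- is a node.
  · refine cast (congrArg (Convex ℝ) ?_) ((convex_fullCone M).affine_preimage (paramMap Q q))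
    rw [← complementaryRange_eq_fullCone hM, eq_comm]
    ext θ
    simp only [mem_union, mem_iUnion, Subtype.exists, mem_preimage, complementaryRange,
      mem_ofPred_eq, exists_prop]
    constructor
    · rintro (⟨B, -, h⟩ | ⟨B, -, h⟩)
      exacts [⟨B.1, B.2.1, h⟩, ⟨B.1, B.2.1, h⟩]
    · rintro ⟨B, hB, h⟩
      by_cases hr : (criticalDomainGraph M Q q).Reachable B₁ ⟨B, hB, hS.dim_eq hQ hB ⟨θ, h⟩⟩
      exacts [Or.inl ⟨_, hr, h⟩, Or.inr ⟨_, hr, h⟩]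
  -- Dimension `d` would force `B = B'`, and `d - 1` would make `B'` reachable.
  · rintro ⟨B, hB⟩ ⟨B', hB'⟩
    have hne : B ≠ B' := by
      rintro rfl
      exact hB' hB
    have h1 : dim (paramCell M Q q B.1 ∩ paramCell M Q q B'.1) ≠ d := fun h =>
      hne (Subtype.ext (hS.eq_of_dim_inter_eq hM.1 B.2.1 B'.2.1 h))
    have h2 : dim (paramCell M Q q B.1 ∩ paramCell M Q q B'.1) ≠ (d : ℤ) - 1 := fun h =>
      hB' (hB.trans (SimpleGraph.Adj.reachable ⟨hne, (dim_criticalDomain_inter hQ).trans h⟩))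
    have h3 := dim_le (paramCell M Q q B.1 ∩ paramCell M Q q B'.1)
    show dim (paramCell M Q q B.1 ∩ paramCell M Q q B'.1) < _
    omega

theorem GeneralPosition.nonempty_node (hS : GeneralPosition M Q q) (hM : Sufficient M)
    (hQ : Q.rank = d) (h : (feasibleParams M Q q).Nonempty) : Nonempty (Node M Q q) := by
  obtain ⟨θ, w, z, hwz, hw, hz, -⟩ := h
  have hmem : paramMap Q q θ ∈ complementaryRange M := by
    rw [complementaryRange_eq_fullCone hM, paramMap_apply, ← hwz]
    exact mem_fullCone hw hz
  obtain ⟨B, hB, hθ⟩ := mem_iUnion₂.1 hmem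
  exact ⟨⟨B, hB, hS.dim_eq hQ hB ⟨θ, hθ⟩⟩⟩

end PLCP

theorem mainTheorem4 (n d : ℕ) (M : Matrix (Fin n) (Fin n) ℝ) (Q : Matrix (Fin n) (Fin d) ℝ)
    (q : Fin n → ℝ) (hM : PLCP.Sufficient M) (hQ : Q.rank = d)
    (hS : PLCP.GeneralPosition M Q q) :
    (PLCP.criticalDomainGraph M Q q).Preconnected ∧
      ((PLCP.feasibleParams M Q q).Nonempty → (PLCP.criticalDomainGraph M Q q).Connected) :=
  ⟨hS.preconnected_criticalDomainGraph hM hQ, fun h =>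
    { preconnected := hS.preconnected_criticalDomainGraph hM hQ
      nonempty := hS.nonempty_node hM hQ h }⟩
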